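/- **Conventions.** A finite simplicial complex $X$ is a family of nonempty subsets of a finite linearly ordered set, closed under passing to nonempty subsets; its simplices are oriented by the order. $X_k$ is the set of $k$-simplices and $X^{(k)}$ the $k$-skeleton of $X$. All homology is reduced (the simplicial chain complex is augmented in degree $-1$ by the empty set), with integer coefficients unless stated otherwise, and $\beta_k=\operatorname{rank}H_k$. A set $S\subset X_k$ is a *$k$-spanning acycle* if the subcomplex $X_S=S\sqcup X^{(k-1)}$ satisfies $H_k(X_S)=0$ and $|H_{k-1}(X_S)|<\infty$; $\mathcal S^{(k)}$ is the set of $k$-spanning acycles. A *filtration* of $X$ is a family of subcomplexes $X(t)\subset X$, $t\in\mathbb R_{\ge 0}$, with $X(t)\subset X(t')$ for $t\le t'$, $X(t)=\bigcap_{t'>t}X(t')$, and $X(T)=X$ for some $T$. The birth time of a simplex $\sigma$ is $t_\sigma=\min\{t\mid\sigma\in X(t)\}$, and $\mathrm{wt}(S)=\sum_{\sigma\in S}t_\sigma$ for a set $S$ of simplices. Let $K$ be a field of characteristic zero. The $k$-th persistent homology of the filtration is the graded module over the monoid ring $K[\mathbb R_{\ge 0}]$ with degree $t$ part $H_k(X(t);K)$,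 on which $z^{t-s}$ acts by the maps $H_k(X(s);K)\to H_k(X(t);K)$ induced by inclusion. A *persistence diagram* of it is a finite list of pairs $(b_i,d_i)$ with $0\le b_i<d_i\le\infty$ such that it is isomorphic, as a graded module, to $\bigoplus_{i}(z^{b_i})/(z^{d_i})$, where $(z^{b_i})/(z^{d_i})$ stands for $(z^{b_i})$ if $d_i=\infty$. The *lifetime sum* is $L_k=\sum_i(d_i-b_i)\in[0,\infty]$. **Theorem 1.1.** Let $X$ be a finite simplicial complex and $1\le d\le\dim X$ an integer such that $$\beta_{d-1}(X^{(d)})=\beta_{d-2}(X^{(d-1)})=0,$$ and let $\{X(t)\}_{t\in\mathbb R_{\ge 0}}$ be a filtration of $X$. Then $\mathcal S^{(d)}$ and $\mathcal S^{(d-1)}$ are nonempty, the $(d-1)$-st persistent homology of the filtration has a persistence diagram, and for every such diagram the lifetime sum $L_{d-1}$ is finite and $$L_{d-1}=\min_{T\in\mathcal S^{(d)}}\mathrm{wt}(T)-\max_{S\in\mathcal S^{(d-1)}}\mathrm{wt}(X_{d-1}\setminus S)=\int_0^\infty\beta_{d-1}(t)\,dt,$$ where $\beta_{d-1}(t)=\beta_{d-1}(X(t))$,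 an integrable function of $t$. -/

import Mathlib

open scoped NNReal ENNReal

/-!
Finite simplicial complexes are Mathlib's `PreAbstractSimplicialComplex V` on a finite linearly
ordered vertex type `V`: families of nonempty finite sets closed under nonempty subsets.
(A subcomplex need not contain every vertex, so singletons are not required to be faces.)
Simplices are oriented by the order of `V`.  Dimensions are integers, so that the
augmentation degree `-1` of reduced homology is available.
-/

namespace SimplicialPersistence

section Complex

variable {V : Type*}

/-- `X_k`, the finite set of `k`-simplices of `X`. -/
noncomputable def simplices [Fintype V] (X : PreAbstractSimplicialComplex V) (k : ℤ) :
    Finset (Finset V) :=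
  open Classical in Finset.univ.filter fun σ => σ ∈ X ∧ (σ.card : ℤ) = k + 1

/-- The dimension of `X`, the largest dimension of a simplex (`⊥` if there is no simplex). -/
noncomputable def dim [Fintype V] (X : PreAbstractSimplicialComplex V) : WithBot ℕ :=
  open Classical in
  (Finset.univ.filter fun σ : Finset V => σ ∈ X).sup fun σ => ((σ.card - 1 : ℕ) : WithBot ℕ)

/-- The `k`-skeleton `X^(k)`: the simplices of `X` of dimension at most `k`. -/
def skeleton (X : PreAbstractSimplicialComplex V) (k : ℤ) : PreAbstractSimplicialComplex V where
  faces := {σ | σ ∈ X ∧ (σ.card : ℤ) ≤ k + 1}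
  isRelLowerSet_faces := by
    rintro σ ⟨hσ, hk⟩
    refine ⟨(X.isRelLowerSet_faces hσ).1, fun τ hτ hne => ⟨?_, ?_⟩⟩
    · exact (X.isRelLowerSet_faces hσ).2 hτ hne
    · have := Finset.card_le_card hτ
      omega

/-- `X_S = S ⊔ X^(k-1)` for a set `S` of `k`-simplices of `X`. -/
def subcomplexOf (X : PreAbstractSimplicialComplex V) (k : ℤ) (S : Finset (Finset V)) :
    PreAbstractSimplicialComplex V where
  faces := {σ | σ ∈ X ∧ ((σ.card : ℤ) ≤ k ∨ (σ.card : ℤ) = k + 1 ∧ σ ∈ S)}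
  isRelLowerSet_faces := by
    rintro σ ⟨hσ, hk⟩
    refine ⟨(X.isRelLowerSet_faces hσ).1, fun τ hτ hne => ⟨?_, ?_⟩⟩
    · exact (X.isRelLowerSet_faces hσ).2 hτ hne
    · have hle := Finset.card_le_card hτ
      rcases hk with hk | ⟨hk, hS⟩
      · left
        omega
      · by_cases heq : τ.card = σ.card
        · right
          rw [Finset.eq_of_subset_of_card_le hτ heq.ge]
          exact ⟨hk, hS⟩
        · left
          omega

end Complex

section Homology

variable {V : Type*} (R : Type*) [CommRing R]

/-- The chain group `C_k(X)` with coefficients in `R`: the formal linear combinations of finite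
vertex sets (given by their coefficients) that only involve `k`-simplices of `X`.
In degree `-1` they only involve the empty set (augmentation). -/
def chains (X : PreAbstractSimplicialComplex V) (k : ℤ) : Submodule R (Finset V → R) where
  carrier := {c | ∀ σ, ¬ ((σ ∈ X ∨ σ = ∅) ∧ (σ.card : ℤ) = k + 1) → c σ = 0}
  add_mem' hc hc' σ hσ := by simp [hc σ hσ, hc' σ hσ]
  zero_mem' _ _ := rfl
  smul_mem' r _ hc σ hσ := by simp [hc σ hσ]

theorem chains_mono {X Y : PreAbstractSimplicialComplex V} (h : X ≤ Y) (k : ℤ) :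
    chains R X k ≤ chains R Y k :=
  fun _ hc σ hσ => hc σ fun hX => hσ ⟨hX.1.imp (fun hX' => h hX') id, hX.2⟩

/-- The boundary operator: `⟨v₀ ⋯ v_k⟩ ↦ ∑ j, (-1)^j ⟨v₀ ⋯ v̂_j ⋯ v_k⟩` for `v₀ < ⋯ < v_k`;
the position `j` of a vertex `v` is the number of smaller vertices of the simplex. -/
noncomputable def boundary [Fintype V] [LinearOrder V] : (Finset V → R) →ₗ[R] (Finset V → R) :=
  Fintype.linearCombination R fun σ : Finset V =>
    ∑ v ∈ σ, Pi.single (σ.erase v) ((-1 : R) ^ (σ.filter (· < v)).card)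

variable [Fintype V] [LinearOrder V]

/-- The cycles `Z_k(X) = ker (∂ : C_k(X) → C_{k-1}(X))`. -/
noncomputable def cycles (X : PreAbstractSimplicialComplex V) (k : ℤ) :
    Submodule R (Finset V → R) :=
  chains R X k ⊓ LinearMap.ker (boundary R)

/-- The boundaries `B_k(X) = im (∂ : C_{k+1}(X) → C_k(X))`. -/
noncomputable def boundaries (X : PreAbstractSimplicialComplex V) (k : ℤ) :
    Submodule R (Finset V → R) :=
  (chains R X (k + 1)).map (boundary R)

/-- The reduced homology `H_k(X; R) = Z_k(X) / B_k(X)`. -/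
abbrev Homology (X : PreAbstractSimplicialComplex V) (k : ℤ) : Type _ :=
  cycles R X k ⧸ (boundaries R X k).submoduleOf (cycles R X k)

theorem cycles_mono {X Y : PreAbstractSimplicialComplex V} (h : X ≤ Y) (k : ℤ) :
    cycles R X k ≤ cycles R Y k :=
  inf_le_inf_right _ (chains_mono R h k)

theorem boundaries_mono {X Y : PreAbstractSimplicialComplex V} (h : X ≤ Y) (k : ℤ) :
    boundaries R X k ≤ boundaries R Y k :=
  Submodule.map_mono (chains_mono R h (k + 1))

/-- The map `H_k(X; R) → H_k(Y; R)` induced by an inclusion `X ≤ Y`. -/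
noncomputable def homologyMap {X Y : PreAbstractSimplicialComplex V} (h : X ≤ Y) (k : ℤ) :
    Homology R X k →ₗ[R] Homology R Y k :=
  Submodule.mapQ _ _ (Submodule.inclusion (cycles_mono R h k))
    fun _ hx => boundaries_mono R h k hx

/-- The Betti number `β_k(X)`, the rank of the integral reduced homology `H_k(X)`. -/
noncomputable def betti (X : PreAbstractSimplicialComplex V) (k : ℤ) : ℕ :=
  Module.finrank ℤ (Homology ℤ X k)

/-- `S` is a `k`-spanning acycle of `X`: a set of `k`-simplices of `X` such that, in integral
reduced homology, `H_k(X_S) = 0` and `H_{k-1}(X_S)` is finite. -/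
def IsSpanningAcycle (X : PreAbstractSimplicialComplex V) (k : ℤ)
    (S : Finset (Finset V)) : Prop :=
  S ⊆ simplices X k ∧ Subsingleton (Homology ℤ (subcomplexOf X k S) k) ∧
    Finite (Homology ℤ (subcomplexOf X k S) (k - 1))

end Homology

section Filtrations

variable {V : Type*}

/-- A right continuous filtration of `X` by subcomplexes, indexed by the nonnegative reals,
that is equal to `X` at some time. -/
structure Filtration (X : PreAbstractSimplicialComplex V) where
  /-- the subcomplex `X(t)` -/
  complex : ℝ≥0 → PreAbstractSimplicialComplex V
  le : ∀ t, complex t ≤ X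
  mono : Monotone complex
  right_cont : ∀ t σ, (∀ t', t < t' → σ ∈ complex t') → σ ∈ complex t
  saturated : ∃ T, complex T = X

variable {X : PreAbstractSimplicialComplex V}

/-- The birth time `t_σ = min {t | σ ∈ X(t)}` of a simplex `σ` of `X`. -/
noncomputable def birth (F : Filtration X) (σ : Finset V) : ℝ≥0 :=
  sInf {t | σ ∈ F.complex t}

/-- The weight `wt(S) = ∑_{σ ∈ S} t_σ` of a set of simplices. -/
noncomputable def weight (F : Filtration X) (S : Finset (Finset V)) : ℝ :=
  ∑ σ ∈ S, (birth F σ : ℝ)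

/-- The degree `t` part of the direct sum of the interval modules
`(z^{b_i}) / (z^{e_i})` (of `(z^{b_i})` if `e_i = ∞`): one copy of `K` for each `i` with
`b_i ≤ t < e_i`. It is realized as the families in `K^n` vanishing at all other indices. -/
def intervalSum (K : Type*) [Field K] {n : ℕ} (b : Fin n → ℝ≥0) (e : Fin n → ℝ≥0∞) (t : ℝ≥0) :
    Submodule K (Fin n → K) where
  carrier := {x | ∀ i, ¬ (b i ≤ t ∧ (t : ℝ≥0∞) < e i) → x i = 0}
  add_mem' hx hy i hi := by simp [hx i hi, hy i hi]
  zero_mem' _ _ := rfl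
  smul_mem' c _ hx i hi := by simp [hx i hi]

/-- The multiplication by `z^{t-s}` from degree `s` to degree `t` on that direct sum: it keeps
the coordinates that are alive at time `t` and kills the others. -/
noncomputable def intervalSumMap (K : Type*) [Field K] {n : ℕ} (b : Fin n → ℝ≥0)
    (e : Fin n → ℝ≥0∞) (s t : ℝ≥0) : intervalSum K b e s →ₗ[K] intervalSum K b e t where
  toFun x := ⟨fun i => open Classical in if b i ≤ t ∧ (t : ℝ≥0∞) < e i then x.1 i else 0,
    fun _ hi => if_neg hi⟩
  map_add' x y := by
    ext i
    by_cases h : b i ≤ t ∧ (t : ℝ≥0∞) < e i <;> simp [h]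
  map_smul' c x := by
    ext i
    by_cases h : b i ≤ t ∧ (t : ℝ≥0∞) < e i <;> simp [h]

/-- The pairs `(b_i, e_i)`, `i < n`, form the `k`-th persistence diagram of the filtration:
`b_i < e_i ≤ ∞`, and the (reduced) persistent homology `H_k` of the filtration with coefficients
in `K`, i.e. the graded module with degree `t` part `H_k(X(t); K)` on which `z^{t-s}` acts by the
maps `H_k(X(s); K) → H_k(X(t); K)` induced by inclusion, is isomorphic, as a graded module, to the
direct sum of the interval modules `(z^{b_i}) / (z^{e_i})`, resp. `(z^{b_i})` for `e_i = ∞`. -/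
def IsPersistenceDiagram [Fintype V] [LinearOrder V] (K : Type*) [Field K] (F : Filtration X) (k : ℤ)
    {n : ℕ} (b : Fin n → ℝ≥0) (e : Fin n → ℝ≥0∞) : Prop :=
  (∀ i, (b i : ℝ≥0∞) < e i) ∧
    ∃ Φ : ∀ t, Homology K (F.complex t) k ≃ₗ[K] intervalSum K b e t,
      ∀ (s t : ℝ≥0) (hst : s ≤ t) (h : Homology K (F.complex s) k),
        Φ t (homologyMap K (F.mono hst) k h) = intervalSumMap K b e s t (Φ s h)

/-- The lifetime sum `∑ i, (e_i - b_i)` of a persistence diagram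
(it is `∞` as soon as some `e_i` is). -/
noncomputable def lifetimeSum {n : ℕ} (b : Fin n → ℝ≥0) (e : Fin n → ℝ≥0∞) : ℝ≥0∞ :=
  ∑ i, (e i - (b i : ℝ≥0∞))

end Filtrations

end SimplicialPersistence

open SimplicialPersistence

namespace SimplicialPersistence

open Module

/-! Everything reduces to the ranks `boundaryRank` of sets A of simplices, written r(A).
Rank-nullity gives β_k(Y) = |Y_k| - r(Y_k) - r(Y_{k+1}) (`betti_add`). Hence, when β_{k-1}(X^(k)) =
0, the k-spanning acycles are exactly the bases of the matroid of boundary vectors of X_k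
(`isSpanningAcycle_iff`).

The greedy algorithm gives a basis B that spans every sublevel set of the birth time, so B has
exactly r(X_k) - r(X(t)_k) elements unborn at time t, and no basis has fewer. A weight is the
integral over t of the number of unborn elements (`integral_card_filter_lt`), so B has minimal
weight. For greedy T in degree d and S in degree d-1, subtracting the rank identity for X(t) from
the one for X^(d) shows that β_{d-1}(t) is the number of unborn elements of T minus that of X_{d-1}
\ S. Integrating gives the difference of weights (`exists_extremal_weights`).

In a diagram, β_{d-1}(t) counts the intervals [b_i, d_i) containing t, so its integral is also the
lifetime sum (`lifetimeSum_eq_lintegral`). A diagram exists because cycles and boundaries form two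
chains of subspaces of one finite-dimensional space, and two chains have a common adapted basis
(`exists_adapted_basis`). -/

/-! ### Ranks over ℤ and over fields of characteristic zero -/

theorem finrank_span_intCast (K : Type*) [Field K] [CharZero K] {ι : Type*} [Finite ι]
    {S : Set (ι → ℤ)} (hS : S.Finite) :
    finrank K (Submodule.span K ((fun f i => (f i : K)) '' S)) =
      finrank ℤ (Submodule.span ℤ S) := by
  have : Module.Finite ℤ (Submodule.span ℤ S) := Module.Finite.span_of_finite ℤ hS
  let φ : (ι → ℤ) →ₗ[ℤ] (ι → K) := (Algebra.linearMap ℤ K).compLeft ι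
  let b := finBasis ℤ (Submodule.span ℤ S)
  have hb : LinearIndependent ℤ fun i => (b i : ι → ℤ) :=
    b.linearIndependent.map' (Submodule.span ℤ S).subtype (Submodule.ker_subtype _)
  have hspan : Submodule.span ℤ (Set.range fun i => (b i : ι → ℤ)) = Submodule.span ℤ S := by
    have := congrArg (Submodule.map (Submodule.span ℤ S).subtype) b.span_eq
    rw [Submodule.map_span, ← Set.range_comp, Submodule.map_top, Submodule.range_subtype] at this
    exact this
  -- Characteristic zero enters here: an integral basis of the lattice stays independent over K, and
  -- it spans the same K-space as S.
  have hK : LinearIndependent K fun i => φ (b i : ι → ℤ) :=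
    (linearIndependent_algebraMap_comp_iff (R := ℤ) (S := K)).2 hb
  have hφ : ∀ A : Set (ι → ℤ), Submodule.span K (φ '' A) =
      Submodule.span K (φ '' (Submodule.span ℤ A : Set (ι → ℤ))) := fun A => by
    rw [← Submodule.map_coe, Submodule.map_span, Submodule.span_span_of_tower]
  have hSK : Submodule.span K (φ '' S) = Submodule.span K (Set.range fun i => φ (b i)) := by
    rw [hφ S, ← congrArg (fun N : Submodule ℤ (ι → ℤ) => Submodule.span K (φ '' N)) hspan, ← hφ,
      ← Set.range_comp]
    rfl
  change finrank K (Submodule.span K (φ '' S)) = _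
  rw [hSK, finrank_span_eq_card hK, Fintype.card_fin]

theorem finite_iff_finrank_eq_zero (M : Type*) [AddCommGroup M] [Module.Finite ℤ M] :
    Finite M ↔ finrank ℤ M = 0 := by
  rw [Module.finrank_eq_zero_iff_isTorsion]
  constructor
  · intro h x
    obtain ⟨n, hn, hx⟩ := isOfFinAddOrder_iff_nsmul_eq_zero.1 (isOfFinAddOrder_of_finite x)
    exact ⟨⟨(n : ℤ), mem_nonZeroDivisors_of_ne_zero (by omega)⟩, by
      simpa [Submonoid.smul_def] using hx⟩
  · intro h
    exact Module.finite_of_fg_torsion M h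

/-! ### Betti numbers in terms of boundary ranks -/

section Rank

variable {V : Type*} [Fintype V]

/-- The `k`-simplices of `Y` together with the empty simplex in degree `-1`. -/
noncomputable def augSimplices (Y : PreAbstractSimplicialComplex V) (k : ℤ) :
    Finset (Finset V) :=
  open Classical in Finset.univ.filter fun σ => (σ ∈ Y ∨ σ = ∅) ∧ (σ.card : ℤ) = k + 1

theorem mem_augSimplices {Y : PreAbstractSimplicialComplex V} {k : ℤ} {σ : Finset V} :
    σ ∈ augSimplices Y k ↔ (σ ∈ Y ∨ σ = ∅) ∧ (σ.card : ℤ) = k + 1 := by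
  simp [augSimplices]

theorem mem_simplices {Y : PreAbstractSimplicialComplex V} {k : ℤ} {σ : Finset V} :
    σ ∈ simplices Y k ↔ σ ∈ Y ∧ (σ.card : ℤ) = k + 1 := by
  simp [simplices]

theorem augSimplices_eq_simplices (Y : PreAbstractSimplicialComplex V) {k : ℤ} (hk : 0 ≤ k) :
    augSimplices Y k = simplices Y k := by
  ext σ
  rw [mem_augSimplices, mem_simplices]
  refine and_congr_left fun h => or_iff_left ?_
  rintro rfl
  simp at h
  omega

variable [LinearOrder V] (R : Type*) [CommRing R]

/-- The boundary of a single simplex. -/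
noncomputable def simplexBoundary (σ : Finset V) : Finset V → R :=
  ∑ v ∈ σ, Pi.single (σ.erase v) ((-1 : R) ^ (σ.filter (· < v)).card)

theorem boundary_single (σ : Finset V) (r : R) :
    boundary R (Pi.single σ r) = r • simplexBoundary R σ := by
  simp [boundary, simplexBoundary, Fintype.linearCombination_apply_single]

/-- The rank of the boundary operator restricted to the span of a set of simplices. -/
noncomputable def boundaryRank (A : Finset (Finset V)) : ℕ :=
  finrank R (Submodule.span R (simplexBoundary R '' (A : Set (Finset V))))

theorem boundaryRank_eq_int (K : Type*) [Field K] [CharZero K] (A : Finset (Finset V)) :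
    boundaryRank K A = boundaryRank ℤ A := by
  unfold boundaryRank
  rw [← finrank_span_intCast K (A.finite_toSet.image _), Set.image_image]
  have h : simplexBoundary K = fun (σ : Finset V) τ => (simplexBoundary ℤ σ τ : K) := by
    ext σ τ
    simp [simplexBoundary, Finset.sum_apply, Pi.single_apply, apply_ite (Int.cast : ℤ → K)]
  rw [h]

theorem chains_eq_span (Y : PreAbstractSimplicialComplex V) (k : ℤ) :
    chains R Y k =
      Submodule.span R ((fun σ => Pi.single σ (1 : R)) '' (augSimplices Y k : Set (Finset V))) := by
  refine le_antisymm (fun c hc => ?_) (Submodule.span_le.2 ?_)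
  · rw [← Finset.univ_sum_single c]
    refine Submodule.sum_mem _ fun σ _ => ?_
    by_cases hσ : σ ∈ augSimplices Y k
    · rw [show (Pi.single σ (c σ) : Finset V → R) = c σ • Pi.single σ 1 by
        rw [← Pi.single_smul, smul_eq_mul, mul_one]]
      exact Submodule.smul_mem _ _ (Submodule.subset_span ⟨σ, hσ, rfl⟩)
    · rw [hc σ (fun h => hσ (mem_augSimplices.2 h)), Pi.single_zero]
      exact Submodule.zero_mem _
  · rintro _ ⟨σ, hσ, rfl⟩ τ hτ
    refine Pi.single_eq_of_ne ?_ _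
    rintro rfl
    exact hτ (mem_augSimplices.1 hσ)

theorem finrank_chains [Nontrivial R] (Y : PreAbstractSimplicialComplex V) (k : ℤ) :
    finrank R (chains R Y k) = (augSimplices Y k).card := by
  have h : LinearIndependent R
      fun σ : (augSimplices Y k : Set (Finset V)) =>
        (Pi.single (σ : Finset V) (1 : R) : Finset V → R) := by
    have := (Pi.basisFun R (Finset V)).linearIndependent.comp _
      (Subtype.val_injective (p := (· ∈ (augSimplices Y k : Set (Finset V)))))
    simpa [Function.comp_def] using this
  rw [chains_eq_span, Set.image_eq_range, finrank_span_eq_card h]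
  simp

theorem boundaries_eq_span (Y : PreAbstractSimplicialComplex V) (k : ℤ) :
    boundaries R Y k =
      Submodule.span R (simplexBoundary R '' (augSimplices Y (k + 1) : Set (Finset V))) := by
  rw [boundaries, chains_eq_span, Submodule.map_span, Set.image_image]
  simp [boundary_single]

theorem boundary_simplexBoundary (σ : Finset V) : boundary R (simplexBoundary R σ) = 0 := by
  simp only [simplexBoundary, map_sum, boundary_single, Finset.smul_sum, Finset.sum_sigma']
  refine Finset.sum_involution (fun p _ => ⟨p.2, p.1⟩) ?_ ?_ ?_ ?_
  · rintro ⟨v, w⟩ h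
    simp only [Finset.mem_sigma, Finset.mem_erase] at h
    obtain ⟨hv, hne, hw⟩ := h
    -- Deleting the smaller vertex a lowers the position of b by one, while deleting b leaves that
    -- of a unchanged. The two orders of deletion therefore carry opposite signs, and the involution
    -- swapping them cancels the double sum.
    have key : ∀ a b : V, a ∈ σ → b ∈ σ → a < b →
        ((σ.erase a).filter (· < b)).card + 1 = (σ.filter (· < b)).card ∧
        ((σ.erase b).filter (· < a)).card = (σ.filter (· < a)).card := fun a b ha hb hab => by
      rw [Finset.filter_erase, Finset.filter_erase]
      refine ⟨Finset.card_erase_add_one (by simp [ha, hab]), ?_⟩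
      rw [Finset.erase_eq_of_notMem (by simp [hab.le])]
    simp only [← Pi.single_smul, smul_eq_mul, Finset.erase_right_comm (a := w), ← pow_add]
    rw [← Pi.single_add, Pi.single_eq_zero_iff]
    rcases lt_or_gt_of_ne hne with hlt | hlt
    · obtain ⟨h1, h2⟩ := key w v hw hv hlt
      rw [← h1, h2]
      ring
    · obtain ⟨h1, h2⟩ := key v w hv hw hlt
      rw [← h1, h2]
      ring
  · rintro ⟨v, w⟩ h _ heq
    simp only [Finset.mem_sigma, Finset.mem_erase] at h
    simp only [Sigma.mk.injEq] at heq
    exact h.2.1 heq.1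
  · rintro ⟨v, w⟩ h
    simp only [Finset.mem_sigma, Finset.mem_erase] at h ⊢
    exact ⟨h.2.2, h.2.1.symm, h.1⟩
  · rintro ⟨v, w⟩ _
    rfl

theorem simplexBoundary_mem_chains {Y : PreAbstractSimplicialComplex V} {k : ℤ} {σ : Finset V}
    (hσ : σ ∈ augSimplices Y (k + 1)) : simplexBoundary R σ ∈ chains R Y k := by
  obtain ⟨hY, hc⟩ := mem_augSimplices.1 hσ
  refine Submodule.sum_mem _ fun v hv τ hτ => Pi.single_eq_of_ne ?_ _
  rintro rfl
  refine hτ ⟨?_, ?_⟩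
  · rcases hY with hY | rfl
    · rcases (σ.erase v).eq_empty_or_nonempty with h | h
      · exact Or.inr h
      · exact Or.inl ((Y.isRelLowerSet_faces hY).2 (Finset.erase_subset v σ) h)
    · simp at hv
  · have := Finset.card_erase_add_one hv
    omega

theorem boundaries_le_cycles (Y : PreAbstractSimplicialComplex V) (k : ℤ) :
    boundaries R Y k ≤ cycles R Y k := by
  rw [boundaries_eq_span, Submodule.span_le]
  rintro _ ⟨σ, hσ, rfl⟩
  exact ⟨simplexBoundary_mem_chains R hσ, boundary_simplexBoundary R σ⟩

theorem finrank_boundaries (Y : PreAbstractSimplicialComplex V) (k : ℤ) :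
    finrank R (boundaries R Y k) = boundaryRank R (augSimplices Y (k + 1)) := by
  rw [boundaries_eq_span, boundaryRank]

variable [IsDomain R] [IsPrincipalIdealRing R]

theorem finrank_cycles_add (Y : PreAbstractSimplicialComplex V) (k : ℤ) :
    finrank R (cycles R Y k) + boundaryRank R (augSimplices Y k) = (augSimplices Y k).card := by
  let f := (boundary R (V := V)).domRestrict (chains R Y k)
  have h := (LinearMap.ker f).finrank_quotient_add_finrank
  rw [f.quotKerEquivRange.finrank_eq, finrank_chains] at h
  have hr : LinearMap.range f =
      Submodule.span R (simplexBoundary R '' (augSimplices Y k : Set (Finset V))) := by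
    rw [LinearMap.range_domRestrict, chains_eq_span, Submodule.map_span, Set.image_image]
    simp [boundary_single]
  have hk : finrank R (LinearMap.ker f) = finrank R (cycles R Y k) := by
    have : cycles R Y k = (LinearMap.ker f).map (chains R Y k).subtype := by
      ext c
      simp [cycles, f, LinearMap.domRestrict_apply, and_comm]
    rw [this]
    exact ((Submodule.equivMapOfInjective _ (Submodule.subtype_injective _) _).finrank_eq)
  rw [hr, hk] at h
  rw [boundaryRank, ← h, add_comm]

/-- Rank-nullity for the boundary on k-chains, combined with the rank of the quotient of cycles by
boundaries. It holds over any principal ideal domain, so it serves both ℤ and K. -/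
theorem finrank_homology_add (Y : PreAbstractSimplicialComplex V) (k : ℤ) :
    finrank R (Homology R Y k) + boundaryRank R (augSimplices Y (k + 1)) +
      boundaryRank R (augSimplices Y k) = (augSimplices Y k).card := by
  rw [← finrank_cycles_add R Y k, ← finrank_boundaries,
    ← ((boundaries R Y k).submoduleOf (cycles R Y k)).finrank_quotient_add_finrank,
    (Submodule.submoduleOfEquivOfLe (boundaries_le_cycles R Y k)).finrank_eq]

theorem betti_add (Y : PreAbstractSimplicialComplex V) (k : ℤ) :
    betti Y k + boundaryRank ℤ (augSimplices Y (k + 1)) + boundaryRank ℤ (augSimplices Y k) =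
      (augSimplices Y k).card :=
  finrank_homology_add ℤ Y k

/-- The same count determines both sides, and boundary ranks over K and over ℤ agree; no universal
coefficient theorem is needed. -/
theorem finrank_homology_eq_betti (K : Type*) [Field K] [CharZero K]
    (Y : PreAbstractSimplicialComplex V) (k : ℤ) : finrank K (Homology K Y k) = betti Y k := by
  have h1 := finrank_homology_add K Y k
  have h2 := betti_add Y k
  rw [boundaryRank_eq_int, boundaryRank_eq_int] at h1
  omega

end Rank

/-! ### The greedy algorithm -/

section Greedy

variable {K E α : Type*} [Field K] [AddCommGroup E] [Module K E] {v : α → E}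

theorem linearIndepOn_iff_finrank_span_eq_card {B : Finset α} :
    LinearIndepOn K v (B : Set α) ↔ finrank K (Submodule.span K (v '' (B : Set α))) = B.card := by
  have h := linearIndependent_iff_card_eq_finrank_span (R := K) (b := fun x : (B : Set α) => v x)
  rw [Set.finrank, ← Set.image_eq_range] at h
  simp only [Finset.coe_sort_coe, Fintype.card_coe] at h
  exact h.trans eq_comm

/-- The output of the greedy algorithm: an independent subset that spans, at every level of the
weight function, the sublevel set of the given set. -/
theorem exists_linearIndepOn_span_sublevel_le {β : Type*} [LinearOrder β] (w : α → β)
    (A : Finset α) :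
    ∃ B ⊆ A, LinearIndepOn K v (B : Set α) ∧ ∀ t,
      Submodule.span K (v '' {a | a ∈ A ∧ w a ≤ t}) ≤
        Submodule.span K (v '' {a | a ∈ B ∧ w a ≤ t}) := by
  classical
  induction A using Finset.induction_on_max_value w with
  | empty => exact ⟨∅, subset_rfl, by simp, fun t => by simp⟩
  | insert a A ha hmax ih =>
    obtain ⟨B, hBA, hB, hspan⟩ := ih
    -- Elements are added in order of increasing weight. Below the weight of `a` the sublevel sets
    -- do not change; from that weight on they contain all earlier elements, so it suffices to test
    -- `v a` against the whole span of `B`.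
    have hlow : ∀ t, ¬ w a ≤ t → {x | x ∈ insert a A ∧ w x ≤ t} = {x | x ∈ A ∧ w x ≤ t} := by
      intro t ht
      ext x
      simp only [Finset.mem_insert, Set.mem_ofPred_eq]
      refine ⟨?_, fun h => ⟨Or.inr h.1, h.2⟩⟩
      rintro ⟨rfl | h, h'⟩
      exacts [absurd h' ht, ⟨h, h'⟩]
    have hhigh : ∀ t, w a ≤ t → ∀ x ∈ A, w x ≤ t := fun t ht x hx => (hmax x hx).trans ht
    by_cases hva : v a ∈ Submodule.span K (v '' (B : Set α))
    · refine ⟨B, hBA.trans (Finset.subset_insert _ _), hB, fun t => ?_⟩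
      by_cases ht : w a ≤ t
      · rw [Submodule.span_le]
        rintro _ ⟨x, ⟨hx, -⟩, rfl⟩
        have hBt : (B : Set α) ⊆ {b | b ∈ B ∧ w b ≤ t} := fun b hb => ⟨hb, hhigh t ht b (hBA hb)⟩
        rcases Finset.mem_insert.1 hx with rfl | hx
        · exact Submodule.span_mono (Set.image_mono hBt) hva
        · exact hspan t (Submodule.subset_span ⟨x, ⟨hx, hhigh t ht x hx⟩, rfl⟩)
      · rw [hlow t ht]
        exact hspan t
    · refine ⟨insert a B, Finset.insert_subset_insert _ hBA, ?_, fun t => ?_⟩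
      · rw [Finset.coe_insert]
        exact hB.insert hva
      · have hmono : Submodule.span K (v '' {x | x ∈ B ∧ w x ≤ t}) ≤
            Submodule.span K (v '' {x | x ∈ insert a B ∧ w x ≤ t}) :=
          Submodule.span_mono (Set.image_mono fun x hx => ⟨Finset.mem_insert_of_mem hx.1, hx.2⟩)
        by_cases ht : w a ≤ t
        · rw [Submodule.span_le]
          rintro _ ⟨x, ⟨hx, hxt⟩, rfl⟩
          rcases Finset.mem_insert.1 hx with rfl | hx
          · exact Submodule.subset_span ⟨x, ⟨Finset.mem_insert_self _ _, hxt⟩, rfl⟩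
          · exact hmono (hspan t (Submodule.subset_span ⟨x, ⟨hx, hxt⟩, rfl⟩))
        · rw [hlow t ht]
          exact (hspan t).trans hmono

end Greedy

/-! ### Weights as integrals of counting functions -/

section LayerCake

open MeasureTheory

variable {α : Type*} (w : α → ℝ≥0) (A : Finset α)

theorem integrableOn_indicator_lt (a : ℝ≥0) :
    IntegrableOn (fun t : ℝ => if t.toNNReal < a then (1 : ℝ) else 0) (Set.Ioi 0) ∧
      ∫ t in Set.Ioi (0 : ℝ), (if t.toNNReal < a then (1 : ℝ) else 0) = a := by
  have h : Set.EqOn (fun t : ℝ => if t.toNNReal < a then (1 : ℝ) else 0)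
      ((Set.Ioo 0 (a : ℝ)).indicator fun _ => 1) (Set.Ioi 0) := by
    intro t ht
    have : t.toNNReal < a ↔ t ∈ Set.Ioo 0 (a : ℝ) := by
      rw [Real.toNNReal_lt_iff_lt_coe (le_of_lt ht)]
      exact ⟨fun h => ⟨ht, h⟩, fun h => h.2⟩
    simp [Set.indicator_apply, this]
  constructor
  · rw [integrableOn_congr_fun h measurableSet_Ioi]
    refine Integrable.integrableOn ?_
    rw [integrable_indicator_iff measurableSet_Ioo]
    exact integrableOn_const (by simp)
  · rw [setIntegral_congr_fun measurableSet_Ioi h, setIntegral_indicator measurableSet_Ioo]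
    rw [Set.inter_eq_right.2 fun t ht => ht.1]
    simp

/-- Each element contributes the indicator of (0, w a), whose integral is w a. -/
theorem integral_card_filter_lt :
    IntegrableOn (fun t : ℝ => ((A.filter fun a => t.toNNReal < w a).card : ℝ)) (Set.Ioi 0) ∧
      ∫ t in Set.Ioi (0 : ℝ), ((A.filter fun a => t.toNNReal < w a).card : ℝ) =
        ∑ a ∈ A, (w a : ℝ) := by
  simp only [Finset.card_filter, Nat.cast_sum, Nat.cast_ite, Nat.cast_one, Nat.cast_zero]
  constructor
  · exact integrable_finsetSum _ fun a _ => (integrableOn_indicator_lt (w a)).1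
  · rw [integral_finsetSum _ fun a _ => (integrableOn_indicator_lt (w a)).1]
    exact Finset.sum_congr rfl fun a _ => (integrableOn_indicator_lt (w a)).2

end LayerCake

/-! ### Spanning acycles as bases -/

section Acycles

theorem boundaryRank_empty {V : Type*} [LinearOrder V] (R : Type*) [CommRing R] [Nontrivial R] :
    boundaryRank R (∅ : Finset (Finset V)) = 0 := by
  rw [boundaryRank, Finset.coe_empty, Set.image_empty, Submodule.span_empty, finrank_bot]

variable {V : Type*} [Fintype V] {X : PreAbstractSimplicialComplex V}

theorem augSimplices_congr {Y Z : PreAbstractSimplicialComplex V} {k : ℤ}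
    (h : ∀ σ : Finset V, (σ.card : ℤ) = k + 1 → (σ ∈ Y ↔ σ ∈ Z)) :
    augSimplices Y k = augSimplices Z k := by
  ext σ
  rw [mem_augSimplices, mem_augSimplices]
  exact and_congr_left fun hc => or_congr_left (h σ hc)

theorem augSimplices_skeleton {j k : ℤ} (h : j ≤ k) :
    augSimplices (skeleton X k) j = augSimplices X j :=
  augSimplices_congr fun σ hc => ⟨fun h => h.1, fun hX => ⟨hX, by omega⟩⟩

theorem augSimplices_subcomplexOf_of_lt {j k : ℤ} (h : j < k) (S : Finset (Finset V)) :
    augSimplices (subcomplexOf X k S) j = augSimplices X j :=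
  augSimplices_congr fun σ hc => ⟨fun h => h.1, fun hX => ⟨hX, Or.inl (by omega)⟩⟩

theorem augSimplices_subcomplexOf_self {k : ℤ} (hk : 0 ≤ k) {S : Finset (Finset V)}
    (hS : S ⊆ simplices X k) : augSimplices (subcomplexOf X k S) k = S := by
  ext σ
  rw [augSimplices_eq_simplices _ hk, mem_simplices]
  constructor
  · rintro ⟨⟨-, h | h⟩, hc⟩
    exacts [by omega, h.2]
  · intro h
    obtain ⟨hX, hc⟩ := mem_simplices.1 (hS h)
    exact ⟨⟨hX, Or.inr ⟨hc, h⟩⟩, hc⟩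

theorem augSimplices_subcomplexOf_succ {k : ℤ} (hk : 0 ≤ k) (S : Finset (Finset V)) :
    augSimplices (subcomplexOf X k S) (k + 1) = ∅ := by
  ext σ
  rw [augSimplices_eq_simplices _ (by omega), mem_simplices]
  refine ⟨?_, fun h => absurd h (Finset.notMem_empty σ)⟩
  rintro ⟨⟨-, h | h⟩, hc⟩ <;> omega

variable [LinearOrder V]

/-- Without (k+1)-simplices the homology is the cycle group itself, which is free over ℤ, so it
vanishes as soon as its rank does. -/
theorem subsingleton_homology_iff {Y : PreAbstractSimplicialComplex V} {k : ℤ}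
    (h : augSimplices Y (k + 1) = ∅) : Subsingleton (Homology ℤ Y k) ↔ betti Y k = 0 := by
  have hb : boundaries ℤ Y k = ⊥ := by simp [boundaries_eq_span, h]
  have hb' : (boundaries ℤ Y k).submoduleOf (cycles ℤ Y k) = ⊥ := by
    rw [hb]
    simp [Submodule.submoduleOf]
  let e := Submodule.quotEquivOfEqBot _ hb'
  rw [betti, e.finrank_eq, e.toEquiv.subsingleton_congr, finrank_eq_zero_iff_of_free]

/-- The rank identities say that β_k(X_S) = |S| - r(S) and, by the hypothesis on the skeleton,
β_{k-1}(X_S) = r(X_k) - r(S). The two homology conditions are thus independence and maximal rank. -/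
theorem isSpanningAcycle_iff (K : Type*) [Field K] [CharZero K] {k : ℤ} (hk : 0 ≤ k)
    (hX : betti (skeleton X k) (k - 1) = 0) (S : Finset (Finset V)) :
    IsSpanningAcycle X k S ↔ S ⊆ simplices X k ∧
      boundaryRank K S = S.card ∧ S.card = boundaryRank K (simplices X k) := by
  refine and_congr_right fun hS => ?_
  have h0 := betti_add (skeleton X k) (k - 1)
  have h1 := betti_add (subcomplexOf X k S) (k - 1)
  have h2 := betti_add (subcomplexOf X k S) k
  rw [subsingleton_homology_iff (augSimplices_subcomplexOf_succ hk S), finite_iff_finrank_eq_zero,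
    ← betti, boundaryRank_eq_int, boundaryRank_eq_int]
  rw [sub_add_cancel, augSimplices_skeleton le_rfl, augSimplices_skeleton (by omega),
    augSimplices_eq_simplices _ hk] at h0
  rw [sub_add_cancel, augSimplices_subcomplexOf_of_lt (sub_one_lt k),
    augSimplices_subcomplexOf_self hk hS] at h1
  rw [augSimplices_subcomplexOf_succ hk, augSimplices_subcomplexOf_self hk hS,
    boundaryRank_empty] at h2
  omega

end Acycles

/-! ### Birth times and extremal weights -/

section Weights

variable {V : Type*} {X : PreAbstractSimplicialComplex V} (F : Filtration X)

theorem birth_le_iff {σ : Finset V} (hσ : σ ∈ X) {t : ℝ≥0} : birth F σ ≤ t ↔ σ ∈ F.complex t := by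
  obtain ⟨T, hT⟩ := F.saturated
  have hne : {t | σ ∈ F.complex t}.Nonempty := ⟨T, by simpa [hT] using hσ⟩
  refine ⟨fun h => F.right_cont t σ fun t' ht' => ?_, fun h => csInf_le (OrderBot.bddBelow _) h⟩
  obtain ⟨s, hs, hst⟩ := exists_lt_of_csInf_lt hne (h.trans_lt ht')
  exact F.mono hst.le hs

variable [Fintype V]

theorem simplices_complex (t : ℝ≥0) (k : ℤ) :
    simplices (F.complex t) k = (simplices X k).filter fun σ => birth F σ ≤ t := by
  ext σ
  rw [Finset.mem_filter, mem_simplices, mem_simplices]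
  constructor
  · rintro ⟨h, hc⟩
    exact ⟨⟨F.le t h, hc⟩, (birth_le_iff F (F.le t h)).2 h⟩
  · rintro ⟨⟨h, hc⟩, hb⟩
    exact ⟨(birth_le_iff F h).1 hb, hc⟩

variable [LinearOrder V] (K : Type*) [Field K]

theorem boundaryRank_mono {A B : Finset (Finset V)} (h : A ⊆ B) :
    boundaryRank K A ≤ boundaryRank K B :=
  Submodule.finrank_mono (Submodule.span_mono (Set.image_mono (Finset.coe_subset.2 h)))

/-- A maximal independent set of simplices of minimal weight: at all times it has as few unborn
elements as possible. -/
theorem exists_basis_card_filter_lt (w : Finset V → ℝ≥0) (A : Finset (Finset V)) :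
    ∃ B ⊆ A, boundaryRank K B = B.card ∧ B.card = boundaryRank K A ∧
      ∀ t, (B.filter fun σ => t < w σ).card + boundaryRank K (A.filter fun σ => w σ ≤ t) =
        boundaryRank K A := by
  obtain ⟨B, hBA, hB, hspan⟩ :=
    exists_linearIndepOn_span_sublevel_le (K := K) (v := simplexBoundary K) w A
  have hind : ∀ C ⊆ B, boundaryRank K C = C.card := fun C hC =>
    linearIndepOn_iff_finrank_span_eq_card.1 (hB.mono (Finset.coe_subset.2 hC))
  have hlevel : ∀ t, (B.filter fun σ => w σ ≤ t).card =
      boundaryRank K (A.filter fun σ => w σ ≤ t) := fun t => by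
    rw [← hind _ (Finset.filter_subset _ _)]
    refine le_antisymm (boundaryRank_mono K (Finset.filter_subset_filter _ hBA)) ?_
    refine Submodule.finrank_mono ?_
    simpa using hspan t
  obtain ⟨T, hT⟩ : ∃ T, ∀ σ ∈ A, w σ ≤ T := ⟨A.sup w, fun σ hσ => Finset.le_sup hσ⟩
  have hcard : B.card = boundaryRank K A := by
    have := hlevel T
    rwa [Finset.filter_true_of_mem hT,
      Finset.filter_true_of_mem fun σ hσ => hT σ (hBA hσ)] at this
  refine ⟨B, hBA, hind B subset_rfl, hcard, fun t => ?_⟩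
  rw [← hlevel, ← hcard, add_comm]
  simpa using B.card_filter_add_card_filter_not (fun σ => w σ ≤ t)

/-- The born part of a basis is independent inside the sublevel set, so its size is at most the rank
there. Hence no basis has fewer unborn elements than the greedy one. -/
theorem le_card_filter_lt_add (w : Finset V → ℝ≥0) {A B : Finset (Finset V)} (hBA : B ⊆ A)
    (hB : boundaryRank K B = B.card) (hBcard : B.card = boundaryRank K A) (t : ℝ≥0) :
    boundaryRank K A ≤
      (B.filter fun σ => t < w σ).card + boundaryRank K (A.filter fun σ => w σ ≤ t) := by
  have h1 : (B.filter fun σ => w σ ≤ t).card ≤ boundaryRank K (A.filter fun σ => w σ ≤ t) := by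
    rw [← show boundaryRank K (B.filter fun σ => w σ ≤ t) = _ from
      linearIndepOn_iff_finrank_span_eq_card.1
        ((linearIndepOn_iff_finrank_span_eq_card.2 hB).mono
          (Finset.coe_subset.2 (Finset.filter_subset _ _)))]
    exact boundaryRank_mono K (Finset.filter_subset_filter _ hBA)
  have h2 := B.card_filter_add_card_filter_not (fun σ => w σ ≤ t)
  simp only [not_le] at h2
  omega

theorem exists_isLeast_weight [CharZero K] {k : ℤ} (hk : 0 ≤ k)
    (hX : betti (skeleton X k) (k - 1) = 0) :
    ∃ T, IsSpanningAcycle X k T ∧ (∀ S, IsSpanningAcycle X k S → weight F T ≤ weight F S) ∧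
      ∀ t, (T.filter fun σ => t < birth F σ).card + boundaryRank K (simplices (F.complex t) k) =
        boundaryRank K (simplices X k) := by
  obtain ⟨T, hTX, hT, hTcard, hTt⟩ := exists_basis_card_filter_lt K (birth F) (simplices X k)
  refine ⟨T, (isSpanningAcycle_iff K hk hX T).2 ⟨hTX, hT, hTcard⟩, fun S hS => ?_, fun t => ?_⟩
  · obtain ⟨hSX, hS, hScard⟩ := (isSpanningAcycle_iff K hk hX S).1 hS
    obtain ⟨hTi, hTe⟩ := integral_card_filter_lt (birth F) T
    obtain ⟨hSi, hSe⟩ := integral_card_filter_lt (birth F) S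
    rw [weight, weight, ← hTe, ← hSe]
    -- The weights are compared through a pointwise inequality between numbers of unborn simplices.
    refine MeasureTheory.integral_mono hTi hSi fun t => ?_
    have h1 := hTt t.toNNReal
    have h2 := le_card_filter_lt_add K (birth F) hSX hS hScard t.toNNReal
    exact Nat.cast_le.2 (by omega)
  · rw [simplices_complex]
    exact hTt t

/-- The extremal weights exist, and their difference is the integral of the Betti number. -/
theorem exists_extremal_weights {k : ℤ} (hk : 0 ≤ k)
    (h₁ : betti (skeleton X (k + 1)) k = 0) (h₂ : betti (skeleton X k) (k - 1) = 0) :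
    ∃ m M : ℝ,
      IsLeast {w : ℝ | ∃ T, IsSpanningAcycle X (k + 1) T ∧ w = weight F T} m ∧
      IsGreatest {w : ℝ | ∃ S, IsSpanningAcycle X k S ∧
        w = weight F (simplices X k \ S)} M ∧
      MeasureTheory.IntegrableOn (fun t : ℝ => (betti (F.complex t.toNNReal) k : ℝ))
        (Set.Ioi 0) ∧
      ∫ t in Set.Ioi (0 : ℝ), (betti (F.complex t.toNNReal) k : ℝ) = m - M := by
  obtain ⟨T, hT, hTmin, hTt⟩ :=
    exists_isLeast_weight F ℚ (k := k + 1) (by omega) (by rwa [add_sub_cancel_right])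
  obtain ⟨S, hS, hSmin, hSt⟩ := exists_isLeast_weight F ℚ hk h₂
  have hdiff : ∀ S, IsSpanningAcycle X k S →
      weight F (simplices X k \ S) = weight F (simplices X k) - weight F S := fun S hS => by
    rw [eq_sub_iff_add_eq]
    exact Finset.sum_sdiff hS.1
  obtain ⟨hTi, hTe⟩ := integral_card_filter_lt (birth F) T
  obtain ⟨hSi, hSe⟩ := integral_card_filter_lt (birth F) (simplices X k \ S)
  have hbetti : (fun t : ℝ => (betti (F.complex t.toNNReal) k : ℝ)) =
      fun t => ((T.filter fun σ => t.toNNReal < birth F σ).card : ℝ) -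
        (((simplices X k \ S).filter fun σ => t.toNNReal < birth F σ).card : ℝ) := by
    funext t
    generalize t.toNNReal = t
    -- `e0` and `e1` are the rank identities of X^(k+1) and X(t). In their difference the rank
    -- defects in degrees k+1 and k are the unborn counts of `T` and `S`, by `e2` and `e3`.
    have e0 := betti_add (skeleton X (k + 1)) k
    have e1 := betti_add (F.complex t) k
    rw [augSimplices_skeleton le_rfl, augSimplices_skeleton (by omega)] at e0
    rw [h₁] at e0
    rw [augSimplices_eq_simplices _ hk, augSimplices_eq_simplices _ (by omega)] at e0 e1
    have e2 := hTt t
    have e3 := hSt t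
    rw [boundaryRank_eq_int, boundaryRank_eq_int] at e2 e3
    have e4 := (simplices X k).card_filter_add_card_filter_not (fun σ => birth F σ ≤ t)
    rw [← simplices_complex] at e4
    simp only [not_le] at e4
    have e5 : ((simplices X k \ S).filter fun σ => t < birth F σ).card +
        (S.filter fun σ => t < birth F σ).card =
          ((simplices X k).filter fun σ => t < birth F σ).card := by
      simp only [Finset.card_filter]
      exact Finset.sum_sdiff hS.1
    rw [eq_sub_iff_add_eq]
    norm_cast
    omega
  refine ⟨weight F T, weight F (simplices X k \ S), ⟨⟨T, hT, rfl⟩, ?_⟩, ⟨⟨S, hS, rfl⟩, ?_⟩, ?_, ?_⟩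
  · rintro _ ⟨T', hT', rfl⟩
    exact hTmin T' hT'
  · rintro _ ⟨S', hS', rfl⟩
    rw [hdiff S hS, hdiff S' hS']
    exact sub_le_sub_left (hSmin S' hS') _
  · rw [hbetti]
    exact hTi.sub hSi
  · rw [hbetti, MeasureTheory.integral_sub hTi hSi, hTe, hSe]
    rfl

end Weights

/-! ### A common adapted basis for two chains of subspaces -/

section AdaptedBasis

variable {K E : Type*} [Field K] [AddCommGroup E] [Module K E] [FiniteDimensional K E]

theorem exists_lt_forall_inf_le {𝒜 : Set (Submodule K E)} (h𝒜 : IsChain (· ≤ ·) 𝒜)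
    {W : Submodule K E} (hW : W ≠ ⊥) : ∃ P < W, ∀ A ∈ 𝒜, ¬ W ≤ A → A ⊓ W ≤ P := by
  by_cases h : ∃ A ∈ 𝒜, ¬ W ≤ A
  · obtain ⟨P, ⟨hP, hPW⟩, hmax⟩ := wellFounded_gt.has_min {A | A ∈ 𝒜 ∧ ¬ W ≤ A} h
    refine ⟨P ⊓ W, inf_lt_right.2 hPW, fun A hA hAW => inf_le_inf_right _ ?_⟩
    rcases h𝒜.total hA hP with h | h
    · exact h
    · exact (eq_of_le_of_not_lt h (hmax A ⟨hA, hAW⟩)).ge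
  · push Not at h
    exact ⟨⊥, bot_lt_iff_ne_bot.2 hW, fun A hA hAW => absurd (h A hA) hAW⟩

theorem exists_mem_notMem_forall_inf_le_or_mem {ℬ : Set (Submodule K E)}
    (hℬ : IsChain (· ≤ ·) ℬ) {H W : Submodule K E} (hHW : H < W) :
    ∃ w ∈ W, w ∉ H ∧ ∀ B ∈ ℬ, B ⊓ W ≤ H ∨ w ∈ B := by
  by_cases h : ∃ B ∈ ℬ, ¬ B ⊓ W ≤ H
  · obtain ⟨P, ⟨hP, hPH⟩, hmin⟩ := wellFounded_lt.has_min {B | B ∈ ℬ ∧ ¬ B ⊓ W ≤ H} h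
    obtain ⟨w, ⟨hwP, hwW⟩, hwH⟩ := SetLike.not_le_iff_exists.1 hPH
    refine ⟨w, hwW, hwH, fun B hB => or_iff_not_imp_left.2 fun hBH => ?_⟩
    rcases hℬ.total hB hP with h | h
    · exact eq_of_le_of_not_lt h (hmin B ⟨hB, hBH⟩) ▸ hwP
    · exact h hwP
  · push Not at h
    obtain ⟨w, hw, hwH⟩ := SetLike.exists_of_lt hHW
    exact ⟨w, hw, hwH, fun B hB => Or.inl (h B hB)⟩

/-- Induction on W. A hyperplane H of W is chosen to contain the trace on W of every member of 𝒜 not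
containing W, and then w ∈ W \ H is taken in the smallest member of ℬ whose trace leaves H. Every
member of either chain now has its trace in H or contains w, so adding w to an adapted basis of H
keeps it adapted. -/
theorem exists_linearIndepOn_adapted {𝒜 ℬ : Set (Submodule K E)} (h𝒜 : IsChain (· ≤ ·) 𝒜)
    (hℬ : IsChain (· ≤ ·) ℬ) (W : Submodule K E) :
    ∃ s : Set E, LinearIndepOn K id s ∧ Submodule.span K s = W ∧
      ∀ A ∈ 𝒜 ∪ ℬ, A ⊓ W ≤ Submodule.span K (s ∩ A) := by
  induction W using WellFoundedLT.induction with
  | ind W ih =>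
  by_cases hW : W = ⊥
  · subst hW
    exact ⟨∅, linearIndepOn_empty K id, Submodule.span_empty, fun A _ => by simp⟩
  obtain ⟨P, hPW, hP⟩ := exists_lt_forall_inf_le h𝒜 hW
  obtain ⟨H, hPH, hHW⟩ := exists_le_covBy_of_lt hPW
  obtain ⟨s, hs, hspan, hadapt⟩ := ih H hHW.lt
  obtain ⟨w, hwW, hwH, hw⟩ := exists_mem_notMem_forall_inf_le_or_mem hℬ hHW.lt
  have hsup : Submodule.span K (insert w s) = W := by
    rw [Submodule.span_insert, hspan]
    refine (hHW.eq_or_eq le_sup_right (sup_le ?_ hHW.le)).resolve_left fun h => hwH ?_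
    · rwa [Submodule.span_singleton_le_iff_mem]
    · exact h ▸ Submodule.mem_sup_left (Submodule.mem_span_singleton_self w)
  refine ⟨insert w s, hs.id_insert (hspan ▸ hwH), hsup, fun A hA => ?_⟩
  have hcase : A ⊓ W ≤ H ∨ w ∈ A := by
    rcases hA with hA | hA
    · by_cases hWA : W ≤ A
      · exact Or.inr (hWA hwW)
      · exact Or.inl ((hP A hA hWA).trans hPH)
    · exact hw A hA
  have hmono : Submodule.span K (s ∩ A) ≤ Submodule.span K (insert w s ∩ A) :=
    Submodule.span_mono (Set.inter_subset_inter_left _ (Set.subset_insert _ _))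
  rcases hcase with hAH | hwA
  · exact (le_inf inf_le_left hAH).trans ((hadapt A hA).trans hmono)
  · rintro x ⟨hxA, hxW⟩
    rw [SetLike.mem_coe, ← hsup, Submodule.mem_span_insert, hspan] at hxW
    obtain ⟨c, h, hh, rfl⟩ := hxW
    have hhA : h ∈ A := by simpa using A.sub_mem hxA (A.smul_mem c hwA)
    exact Submodule.add_mem _
      (Submodule.smul_mem _ _ (Submodule.subset_span ⟨Set.mem_insert _ _, hwA⟩))
      (hmono (hadapt A hA ⟨hhA, hh⟩))

/-- Two chains of subspaces have a common adapted basis. -/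
theorem exists_adapted_basis {𝒜 ℬ : Set (Submodule K E)} (h𝒜 : IsChain (· ≤ ·) 𝒜)
    (hℬ : IsChain (· ≤ ·) ℬ) :
    ∃ (s : Set E) (v : Basis s K E), ∀ A ∈ 𝒜 ∪ ℬ, ∀ x ∈ A, ∀ i, v i ∉ A → v.repr x i = 0 := by
  obtain ⟨s, hs, hspan, hadapt⟩ := exists_linearIndepOn_adapted h𝒜 hℬ ⊤
  have hs' : LinearIndependent K ((↑) : s → E) := hs
  let v : Basis s K E := Basis.mk hs' (by rw [Subtype.range_coe, hspan])
  have hv : ∀ i, v i = i := fun i => by simp [v]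
  refine ⟨s, v, fun A hA x hx i hi => ?_⟩
  have hx' : x ∈ Submodule.span K (v '' {i | v i ∈ A}) := by
    refine Submodule.span_mono ?_ (hadapt A hA ⟨hx, Submodule.mem_top⟩)
    rintro y ⟨hy, hyA⟩
    exact ⟨⟨y, hy⟩, by simpa [hv] using hyA, hv _⟩
  rw [Basis.mem_span_image] at hx'
  by_contra h
  exact hi (hx' (Finsupp.mem_support_iff.2 h))

end AdaptedBasis

/-! ### Interval decomposition -/

section IntervalDecomposition

/-- Yields the birth and death time of a basis vector; the value ∞ means that the event never
occurs. -/
theorem exists_forall_le_coe_iff {p : ℝ≥0 → Prop} (hp : Monotone p)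
    (hrc : ∀ t, ∃ t' > t, p t' → p t) : ∃ b : ℝ≥0∞, ∀ t : ℝ≥0, b ≤ t ↔ p t := by
  by_cases hne : ∃ t, p t
  · refine ⟨((sInf {t | p t} : ℝ≥0) : ℝ≥0∞), fun t => ?_⟩
    rw [ENNReal.coe_le_coe]
    refine ⟨fun h => ?_, fun h => csInf_le (OrderBot.bddBelow _) h⟩
    obtain ⟨t', ht', hp'⟩ := hrc t
    obtain ⟨s, hs, hst⟩ := exists_lt_of_csInf_lt hne (h.trans_lt ht')
    exact hp' (hp hst.le hs)
  · push Not at hne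
    exact ⟨⊤, fun t => by simp [hne t]⟩

variable {K E : Type*} [Field K] [AddCommGroup E] [Module K E] [FiniteDimensional K E]

/-- The interval decomposition of the quotients of one filtration of a finite-dimensional vector
space by another one. -/
theorem exists_interval_decomposition {Z B : ℝ≥0 → Submodule K E} (hZ : Monotone Z)
    (hB : Monotone B) (hrc : ∀ t, ∃ t' > t, Z t' = Z t ∧ B t' = B t) :
    ∃ (n : ℕ) (b : Fin n → ℝ≥0) (e : Fin n → ℝ≥0∞), (∀ i, (b i : ℝ≥0∞) < e i) ∧
      ∃ f : ∀ t, Z t →ₗ[K] intervalSum K b e t,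
        (∀ t, Function.Surjective (f t)) ∧
        (∀ t, LinearMap.ker (f t) = (B t).submoduleOf (Z t)) ∧
        ∀ (s t : ℝ≥0) (hst : s ≤ t) (x : Z s),
          f t (Submodule.inclusion (hZ hst) x) = intervalSumMap K b e s t (f s x) := by
  classical
  obtain ⟨S, v, hv⟩ := exists_adapted_basis (𝒜 := Set.range Z) (ℬ := Set.range B)
    hZ.isChain_range hB.isChain_range
  have : Finite S := Module.Finite.finite_basis v
  have : Fintype S := Fintype.ofFinite S
  have hvZ : ∀ t, ∀ x ∈ Z t, ∀ i, v i ∉ Z t → v.repr x i = 0 := fun t => hv _ (Or.inl ⟨t, rfl⟩)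
  have hvB : ∀ t, ∀ x ∈ B t, ∀ i, v i ∉ B t → v.repr x i = 0 := fun t => hv _ (Or.inr ⟨t, rfl⟩)
  -- Only basis vectors that are at some time in Z but not in B give intervals; this is what makes
  -- the intervals nonempty.
  let J := {i : S // ∃ t, v i ∈ Z t ∧ v i ∉ B t}
  let ε : Fin (Fintype.card J) ≃ J := (Fintype.equivFin J).symm
  have hb : ∀ j : J, ∃ b : ℝ≥0, ∀ t, b ≤ t ↔ v j.1 ∈ Z t := fun j => by
    obtain ⟨b, hb⟩ := exists_forall_le_coe_iff (p := fun t => v j.1 ∈ Z t)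
      (fun s t hst h => hZ hst h) fun t => by
        obtain ⟨t', ht', h, -⟩ := hrc t
        exact ⟨t', ht', fun h' => h ▸ h'⟩
    obtain ⟨t, ht, -⟩ := j.2
    lift b to ℝ≥0 using ne_top_of_le_ne_top ENNReal.coe_ne_top ((hb t).2 ht)
    exact ⟨b, fun t => by rw [← hb, ENNReal.coe_le_coe]⟩
  have he : ∀ j : J, ∃ e : ℝ≥0∞, ∀ t : ℝ≥0, (t : ℝ≥0∞) < e ↔ v j.1 ∉ B t := fun j => by
    obtain ⟨e, he⟩ := exists_forall_le_coe_iff (p := fun t => v j.1 ∈ B t)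
      (fun s t hst h => hB hst h) fun t => by
        obtain ⟨t', ht', -, h⟩ := hrc t
        exact ⟨t', ht', fun h' => h ▸ h'⟩
    exact ⟨e, fun t => by rw [← he, not_le]⟩
  choose b hb using hb
  choose e he using he
  let g : ∀ t, E →ₗ[K] intervalSum K (fun i => b (ε i)) (fun i => e (ε i)) t := fun t =>
    { toFun := fun x => ⟨fun i => if b (ε i) ≤ t ∧ (t : ℝ≥0∞) < e (ε i)
        then v.repr x (ε i).1 else 0, fun i hi => if_neg hi⟩
      map_add' := fun x y => by
        ext i
        by_cases h : b (ε i) ≤ t ∧ (t : ℝ≥0∞) < e (ε i) <;> simp [h]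
      map_smul' := fun c x => by
        ext i
        by_cases h : b (ε i) ≤ t ∧ (t : ℝ≥0∞) < e (ε i) <;> simp [h] }
  have hg : ∀ t x i, (g t x).1 i = if b (ε i) ≤ t ∧ (t : ℝ≥0∞) < e (ε i)
      then v.repr x (ε i).1 else 0 := fun t x i => rfl
  refine ⟨Fintype.card J, fun i => b (ε i), fun i => e (ε i), fun i => ?_,
    fun t => (g t).domRestrict (Z t), fun t y => ?_, fun t => ?_, fun s t hst x => ?_⟩
  · obtain ⟨t, hZt, hBt⟩ := (ε i).2
    exact (ENNReal.coe_le_coe.2 ((hb _ t).2 hZt)).trans_lt ((he _ t).2 hBt)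
  · refine ⟨⟨∑ i, y.1 i • v (ε i).1, Submodule.sum_mem _ fun i _ => ?_⟩, ?_⟩
    · by_cases hi : b (ε i) ≤ t ∧ (t : ℝ≥0∞) < e (ε i)
      · exact Submodule.smul_mem _ _ ((hb _ t).1 hi.1)
      · rw [y.2 i hi, zero_smul]
        exact Submodule.zero_mem _
    · ext i
      rw [LinearMap.domRestrict_apply, hg]
      split_ifs with hi
      · simp only [map_sum, map_smul, Basis.repr_self, Finsupp.coe_finsetSum, Finset.sum_apply,
          Finsupp.coe_smul, Pi.smul_apply, smul_eq_mul, Finsupp.single_apply]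
        rw [Finset.sum_eq_single i]
        · simp
        · intro j _ hj
          rw [if_neg fun h => hj (ε.injective (Subtype.ext h)), mul_zero]
        · simp
      · exact (y.2 i hi).symm
  · ext ⟨x, hx⟩
    change g t x = 0 ↔ x ∈ B t
    constructor
    · intro h
      have h0 : ∀ i, b (ε i) ≤ t ∧ (t : ℝ≥0∞) < e (ε i) → v.repr x (ε i).1 = 0 := fun i hi => by
        have := congrFun (congrArg Subtype.val h) i
        rwa [hg, if_pos hi] at this
      rw [← v.sum_repr x]
      refine Submodule.sum_mem _ fun i _ => ?_
      by_cases hiB : v i ∈ B t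
      · exact Submodule.smul_mem _ _ hiB
      · have hzero : v.repr x i = 0 := by
          by_cases hiZ : v i ∈ Z t
          · have := h0 (ε.symm ⟨i, t, hiZ, hiB⟩)
            rw [Equiv.apply_symm_apply] at this
            exact this ⟨(hb _ t).2 hiZ, (he _ t).2 hiB⟩
          · exact hvZ t x hx i hiZ
        rw [hzero, zero_smul]
        exact Submodule.zero_mem _
    · intro h
      ext i
      rw [hg]
      split_ifs with hi
      · exact hvB t x h _ ((he _ t).1 hi.2)
      · rfl
  · ext i
    change (g t x).1 i = if b (ε i) ≤ t ∧ (t : ℝ≥0∞) < e (ε i) then (g s x).1 i else 0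
    rw [hg, hg]
    split_ifs with h1 h2
    · rfl
    -- Alive at t but not at s ≤ t means not yet born at s, so the coordinate of x ∈ Z s vanishes by
    -- adaptedness.
    · refine hvZ s x x.2 _ fun h => h2 ⟨(hb _ s).2 h, ?_⟩
      exact (ENNReal.coe_le_coe.2 hst).trans_lt h1.2
    · rfl

end IntervalDecomposition

/-! ### Persistence diagrams and lifetime sums -/

section Diagram

variable {V : Type*} {X : PreAbstractSimplicialComplex V}

/-- Each simplex absent at time t stays absent for a while, and there are finitely many simplices.
-/
theorem exists_gt_complex_eq [Fintype V] (F : Filtration X) (t : ℝ≥0) :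
    ∃ t' > t, F.complex t' = F.complex t := by
  have h : ∀ᶠ t' in nhdsWithin t (Set.Ioi t), ∀ σ, σ ∈ F.complex t' → σ ∈ F.complex t := by
    rw [Filter.eventually_all]
    intro σ
    by_cases hσ : σ ∈ F.complex t
    · exact Filter.Eventually.of_forall fun _ _ => hσ
    · obtain ⟨u, hu, hσu⟩ : ∃ u, t < u ∧ σ ∉ F.complex u := by
        by_contra! h
        exact hσ (F.right_cont t σ h)
      filter_upwards [Ioo_mem_nhdsGT hu] with t' ht' h
      exact absurd (F.mono ht'.2.le h) hσu
  obtain ⟨t', h, ht'⟩ := (h.and self_mem_nhdsWithin).exists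
  exact ⟨t', ht', le_antisymm (fun σ hσ => h σ hσ) (F.mono (le_of_lt ht'))⟩

theorem exists_isPersistenceDiagram [Fintype V] [LinearOrder V] (K : Type*) [Field K]
    (F : Filtration X) (k : ℤ) :
    ∃ (n : ℕ) (b : Fin n → ℝ≥0) (e : Fin n → ℝ≥0∞), IsPersistenceDiagram K F k b e := by
  obtain ⟨n, b, e, hbe, f, hsurj, hker, hcomm⟩ :=
    exists_interval_decomposition (Z := fun t => cycles K (F.complex t) k)
      (B := fun t => boundaries K (F.complex t) k)
      (fun s t hst => cycles_mono K (F.mono hst) k)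
      (fun s t hst => boundaries_mono K (F.mono hst) k)
      (fun t => by
        obtain ⟨t', ht', h⟩ := exists_gt_complex_eq F t
        exact ⟨t', ht', by rw [h], by rw [h]⟩)
  refine ⟨n, b, e, hbe, fun t => (Submodule.quotEquivOfEq _ _ (hker t).symm).trans
    ((f t).quotKerEquivOfSurjective (hsurj t)), fun s t hst h => ?_⟩
  obtain ⟨x, rfl⟩ := Submodule.Quotient.mk_surjective _ h
  exact hcomm s t hst x

theorem finrank_intervalSum (K : Type*) [Field K] {n : ℕ} (b : Fin n → ℝ≥0) (e : Fin n → ℝ≥0∞)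
    (t : ℝ≥0) [DecidablePred fun i => b i ≤ t ∧ (t : ℝ≥0∞) < e i] :
    finrank K (intervalSum K b e t) =
      (Finset.univ.filter fun i => b i ≤ t ∧ (t : ℝ≥0∞) < e i).card := by
  let p : Fin n → Prop := fun i => b i ≤ t ∧ (t : ℝ≥0∞) < e i
  let φ : intervalSum K b e t →ₗ[K] ({i // p i} → K) :=
    (LinearMap.funLeft K K Subtype.val).domRestrict _
  have hφ : Function.Bijective φ := by
    constructor
    · intro x y h
      ext i
      by_cases hi : p i
      · exact congrFun h ⟨i, hi⟩
      · rw [x.2 i hi, y.2 i hi]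
    · intro y
      refine ⟨⟨fun i => if hi : p i then y ⟨i, hi⟩ else 0, fun i hi => dif_neg hi⟩, ?_⟩
      ext i
      exact dif_pos i.2
  rw [(LinearEquiv.ofBijective φ hφ).finrank_eq, finrank_fintype_fun_eq_card,
    Fintype.card_subtype]

open MeasureTheory

theorem lintegral_alive (b : ℝ≥0) (e : ℝ≥0∞) :
    Measurable (fun t : ℝ => open Classical in
      if b ≤ t.toNNReal ∧ (t.toNNReal : ℝ≥0∞) < e then (1 : ℝ≥0∞) else 0) ∧
    ∫⁻ t in Set.Ioi (0 : ℝ), (open Classical in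
      if b ≤ t.toNNReal ∧ (t.toNNReal : ℝ≥0∞) < e then (1 : ℝ≥0∞) else 0) = e - b := by
  classical
  have hmeas : MeasurableSet {t : ℝ | b ≤ t.toNNReal ∧ (t.toNNReal : ℝ≥0∞) < e} :=
    (measurableSet_le measurable_const measurable_real_toNNReal).inter
      (measurableSet_lt measurable_real_toNNReal.coe_nnreal_ennreal measurable_const)
  refine ⟨Measurable.ite hmeas measurable_const measurable_const, ?_⟩
  have hind : (fun t : ℝ => if b ≤ t.toNNReal ∧ (t.toNNReal : ℝ≥0∞) < e then (1 : ℝ≥0∞) else 0) =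
      {t : ℝ | b ≤ t.toNNReal ∧ (t.toNNReal : ℝ≥0∞) < e}.indicator 1 := by
    ext t
    simp [Set.indicator_apply]
  simp only [hind]
  -- Adding the null point 0 makes the set exactly [b, e), also when b = 0.
  rw [Measure.restrict_congr_set Ioi_ae_eq_Ici, lintegral_indicator_one hmeas,
    Measure.restrict_apply hmeas]
  induction e with
  | top =>
    have : {t : ℝ | b ≤ t.toNNReal ∧ (t.toNNReal : ℝ≥0∞) < ⊤} ∩ Set.Ici 0 = Set.Ici (b : ℝ) := by
      ext t
      simp only [Set.mem_inter_iff, Set.mem_ofPred_eq, ENNReal.coe_lt_top, and_true, Set.mem_Ici]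
      refine ⟨fun h => (Real.le_toNNReal_iff_coe_le h.2).1 h.1, fun h => ?_⟩
      have h0 : 0 ≤ t := b.2.trans h
      exact ⟨(Real.le_toNNReal_iff_coe_le h0).2 h, h0⟩
    rw [this, Real.volume_Ici, ENNReal.top_sub_coe]
  | coe e =>
    have : {t : ℝ | b ≤ t.toNNReal ∧ (t.toNNReal : ℝ≥0∞) < e} ∩ Set.Ici 0 =
        Set.Ico (b : ℝ) e := by
      ext t
      simp only [Set.mem_inter_iff, Set.mem_ofPred_eq, ENNReal.coe_lt_coe, Set.mem_Ici,
        Set.mem_Ico]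
      constructor
      · rintro ⟨⟨h1, h2⟩, h0⟩
        exact ⟨(Real.le_toNNReal_iff_coe_le h0).1 h1, (Real.toNNReal_lt_iff_lt_coe h0).1 h2⟩
      · rintro ⟨h1, h2⟩
        have h0 : 0 ≤ t := b.2.trans h1
        exact ⟨⟨(Real.le_toNNReal_iff_coe_le h0).2 h1, (Real.toNNReal_lt_iff_lt_coe h0).2 h2⟩, h0⟩
    rw [this, Real.volume_Ico, ENNReal.ofReal_sub _ b.coe_nonneg, ENNReal.ofReal_coe_nnreal,
      ENNReal.ofReal_coe_nnreal]

/-- Comparing dimensions at each time, the Betti number counts the intervals alive; each contributes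
its length to the integral. -/
theorem lifetimeSum_eq_lintegral [Fintype V] [LinearOrder V] {K : Type*} [Field K] [CharZero K]
    {F : Filtration X} {k : ℤ} {n : ℕ} {b : Fin n → ℝ≥0} {e : Fin n → ℝ≥0∞}
    (h : IsPersistenceDiagram K F k b e) :
    lifetimeSum b e = ∫⁻ t in Set.Ioi (0 : ℝ), (betti (F.complex t.toNNReal) k : ℝ≥0∞) := by
  classical
  obtain ⟨-, Φ, -⟩ := h
  have hbetti : ∀ t, (betti (F.complex t) k : ℝ≥0∞) =
      ∑ i, if b i ≤ t ∧ (t : ℝ≥0∞) < e i then (1 : ℝ≥0∞) else 0 := fun t => by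
    rw [← finrank_homology_eq_betti K, (Φ t).finrank_eq, finrank_intervalSum, Finset.card_filter]
    push_cast
    rfl
  simp only [hbetti]
  rw [lintegral_finsetSum _ fun i _ => (lintegral_alive (b i) (e i)).1]
  exact Finset.sum_congr rfl fun i _ => (lintegral_alive (b i) (e i)).2.symm

end Diagram

end SimplicialPersistence

open SimplicialPersistence
theorem theorem1p1 {V : Type*} [Fintype V] [LinearOrder V] (K : Type*) [Field K] [CharZero K]
    (X : PreAbstractSimplicialComplex V) (d : ℕ) (hd : 1 ≤ d) (hdim : (d : WithBot ℕ) ≤ dim X)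
    (h₁ : betti (skeleton X d) ((d : ℤ) - 1) = 0)
    (h₂ : betti (skeleton X ((d : ℤ) - 1)) ((d : ℤ) - 2) = 0)
    (F : Filtration X) :
    ∃ m M : ℝ,
      IsLeast {w : ℝ | ∃ T, IsSpanningAcycle X d T ∧ w = weight F T} m ∧
      IsGreatest {w : ℝ | ∃ S, IsSpanningAcycle X ((d : ℤ) - 1) S ∧
        w = weight F (simplices X ((d : ℤ) - 1) \ S)} M ∧
      MeasureTheory.IntegrableOn (fun t : ℝ => (betti (F.complex t.toNNReal) ((d : ℤ) - 1) : ℝ))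
        (Set.Ioi 0) ∧
      (∃ (n : ℕ) (b : Fin n → ℝ≥0) (e : Fin n → ℝ≥0∞),
        IsPersistenceDiagram K F ((d : ℤ) - 1) b e) ∧
      ∀ (n : ℕ) (b : Fin n → ℝ≥0) (e : Fin n → ℝ≥0∞),
        IsPersistenceDiagram K F ((d : ℤ) - 1) b e →
          lifetimeSum b e ≠ ⊤ ∧
          (lifetimeSum b e).toReal = m - M ∧
          (lifetimeSum b e).toReal =
            ∫ t in Set.Ioi (0 : ℝ), (betti (F.complex t.toNNReal) ((d : ℤ) - 1) : ℝ) := by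
  obtain ⟨m, M, hm, hM, hint, hmM⟩ := exists_extremal_weights F (k := (d : ℤ) - 1) (by omega)
    (by rwa [sub_add_cancel]) (by rwa [sub_sub])
  rw [sub_add_cancel] at hm
  refine ⟨m, M, hm, hM, hint, exists_isPersistenceDiagram K F _, fun n b e h => ?_⟩
  -- Integrability turns the lower integral into the `ENNReal.ofReal` of a real one, which makes the
  -- lifetime sum finite and excludes infinite intervals.
  have hL : lifetimeSum b e = ENNReal.ofReal
      (∫ t in Set.Ioi (0 : ℝ), (betti (F.complex t.toNNReal) ((d : ℤ) - 1) : ℝ)) := by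
    rw [lifetimeSum_eq_lintegral h, MeasureTheory.ofReal_integral_eq_lintegral_ofReal hint
      (Filter.Eventually.of_forall fun t => Nat.cast_nonneg _)]
    simp only [ENNReal.ofReal_natCast]
  have hreal := congrArg ENNReal.toReal hL
  rw [ENNReal.toReal_ofReal (MeasureTheory.integral_nonneg fun t => Nat.cast_nonneg _)] at hreal
  exact ⟨hL ▸ ENNReal.ofReal_ne_top, hreal.trans hmM, hreal⟩
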